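/- Let $U(2)$ be the group of $2\times 2$ complex unitary matrices and let $dX$ be Haar measure on $U(2)$, normalized to be a probability measure. For $X\in U(2)$ and $s\in\mathbb{C}$ let $\Lambda_X(s)=\det(I-sX^{\dagger})$, where $X^{\dagger}$ is the conjugate transpose of $X$, and let $\Lambda_X'$ denote the derivative of $\Lambda_X$ with respect to $s$. Let $${}_3F_2(a_1,a_2,a_3;b_1,b_2;z)=\sum_{n=0}^\infty \frac{(a_1)_n(a_2)_n(a_3)_n}{(b_1)_n(b_2)_n}\,\frac{z^n}{n!},\qquad (a)_0=1,\quad (a)_n=a(a+1)\cdots(a+n-1)\ (n\ge 1).$$ Then for every real $r$ with $0\le r<1$ the function $X\mapsto\log|\Lambda_X'(r)|$ is integrable over $U(2)$, the series defining ${}_3F_2\left(\tfrac12,\tfrac12,\tfrac12;\tfrac32,\tfrac32;r^2\right)$ converges, and $$\int_{U(2)}\log|\Lambda_X'(r)|\,dX=\frac{2r\,{}_3F_2\left(\tfrac12,\tfrac12,\tfrac12;\tfrac32,\tfrac32;r^2\right)+r\sqrt{1-r^2}+\arcsin r}{\pi}-\frac12 .$$ -/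

import Mathlib

open MeasureTheory

noncomputable section

namespace UnitaryLog

/-- The group `U(N)` of `N × N` complex unitary matrices. -/
abbrev U (N : ℕ) : Type := Matrix.unitaryGroup (Fin N) ℂ

instance instCompactSpace (N : ℕ) : CompactSpace (U N) := by
  refine isCompact_iff_compactSpace.mp ?_
  have hK : IsCompact (Set.pi Set.univ fun _ : Fin N => Set.pi Set.univ fun _ : Fin N =>
      Metric.closedBall (0 : ℂ) 1) :=
    isCompact_univ_pi fun _ => isCompact_univ_pi fun _ => isCompact_closedBall _ _
  refine IsCompact.of_isClosed_subset (X := Matrix (Fin N) (Fin N) ℂ) hK ?_ ?_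
  · exact isClosed_unitary (R := Matrix (Fin N) (Fin N) ℂ)
  · intro A hA i _ j _
    simpa using entry_norm_bound_of_unitary hA i j

instance instMeasurableSpace (N : ℕ) : MeasurableSpace (U N) := borel (U N)

instance instBorelSpace (N : ℕ) : BorelSpace (U N) := ⟨rfl⟩

/-- Haar measure on `U(N)`, normalized to have total mass `1`. -/
def haar (N : ℕ) : Measure (U N) := Measure.haarMeasure ⊤

instance instIsHaarMeasure (N : ℕ) : (haar N).IsHaarMeasure := by
  unfold haar; infer_instance

instance instIsProbabilityMeasure (N : ℕ) : IsProbabilityMeasure (haar N) :=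
  ⟨Measure.haarMeasure_self⟩

/-- The characteristic polynomial `Λ_X(s) = det (I - s X†)`, as a function of `s ∈ ℂ`. -/
def Λ {N : ℕ} (X : U N) (s : ℂ) : ℂ :=
  (1 - s • (X : Matrix (Fin N) (Fin N) ℂ).conjTranspose).det

/-- The rising factorial `(a)_n = a (a + 1) ⋯ (a + n - 1)`. -/
def rising (a : ℝ) (n : ℕ) : ℝ := ∏ i ∈ Finset.range n, (a + i)

/-- The `n`-th term of the series defining `₃F₂(a₁, a₂, a₃; b₁, b₂; z)`. -/
def hyp32Term (a₁ a₂ a₃ b₁ b₂ z : ℝ) (n : ℕ) : ℝ :=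
  rising a₁ n * rising a₂ n * rising a₃ n / (rising b₁ n * rising b₂ n) * (z ^ n / n.factorial)

/-- The generalized hypergeometric function `₃F₂(a₁, a₂, a₃; b₁, b₂; z)`. -/
def hyp32 (a₁ a₂ a₃ b₁ b₂ z : ℝ) : ℝ := ∑' n : ℕ, hyp32Term a₁ a₂ a₃ b₁ b₂ z n

end UnitaryLog

end

open Real Set
open scoped ENNReal

/-! ### The law of `|tr X|` under Haar measure, by comparison with a Gaussian on `ℝ⁴`. -/

namespace UnitaryLog

/-! For `2 × 2` unitary `X`, `Λ_X(s) = 1 - s·conj(tr X) + s²·conj(det X)`, so `|Λ_X'(r)| = |2r - z|`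
with `z = conj(tr X / det X)` and `|z| = |tr X|` (`norm_deriv_Λ`). Multiplying `X` by a scalar
`e^{-iφ}` preserves Haar measure and rotates `z`. Averaging over `φ`, Jensen's formula replaces `log
|2r - z|` by `log max(2r, |z|)` (`integrable_and_integral_log_norm_sub`), so only the law of `|tr
X|` matters.

Dividing `X` by a square root of its determinant gives a unit quaternion whose real part is, up to
sign, `cos θ`. Hence `|tr X| / 2` is distributed as `|cos θ|` under `(2/π) sin² θ dθ` on `(0, π)`
(`lintegral_trace`, `map_trace`). The uniform measure on the 3-sphere enters through a
rotation-invariant Gaussian on `ℝ⁴`.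

What remains is the integral of `sin² θ · log max(r, |cos θ|)` (`integral_sin_sq_mul_log_max`).
Cutting at the angle where the maximum changes and integrating by parts leaves elementary terms,
Euler's integral of `log sin`, whose `log 2` cancels the one from the factor 2, and the integral of
`φ cot φ` up to `arcsin r`. With `x = sin φ` the last is the integral of `arcsin x / x`, whose power
series is `r · ₃F₂` (`arcsinInt_sin`, `mul_hyp32_eq`). -/

/-- Integration of a radial function against a Haar measure, in terms of lower integrals. -/
theorem lintegral_fun_norm {E : Type*} [NormedAddCommGroup E] [NormedSpace ℝ E]
    [MeasurableSpace E] [Nontrivial E] (μ : Measure E) [FiniteDimensional ℝ E] [BorelSpace E]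
    [μ.IsAddHaarMeasure] {f : ℝ → ℝ≥0∞} (hf : Measurable f) :
    ∫⁻ x, f ‖x‖ ∂μ = μ.toSphere univ *
      ∫⁻ y in Ioi (0 : ℝ), ENNReal.ofReal (y ^ (Module.finrank ℝ E - 1)) * f y := by
  calc
    ∫⁻ x, f ‖x‖ ∂μ = ∫⁻ x : ({(0)}ᶜ : Set E), f ‖x.1‖ ∂(μ.comap (↑)) := by
      rw [lintegral_subtype_comap (measurableSet_singleton _).compl fun x ↦ f ‖x‖,
        restrict_compl_singleton]
    _ = ∫⁻ x, f x.2 ∂μ.toSphere.prod (.volumeIoiPow (Module.finrank ℝ E - 1)) := by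
      simpa using! μ.measurePreserving_homeomorphUnitSphereProd.lintegral_comp_emb
        (Homeomorph.measurableEmbedding _) (f ∘ Subtype.val ∘ Prod.snd)
    _ = μ.toSphere univ *
        ∫⁻ x : Ioi (0 : ℝ), f x ∂.volumeIoiPow (Module.finrank ℝ E - 1) := by
      rw [lintegral_prod _ (by fun_prop)]
      simp [mul_comm]
    _ = _ := by
      simp only [Measure.volumeIoiPow]
      rw [lintegral_withDensity_eq_lintegral_mul _ (by fun_prop) (by fun_prop)]
      simp only [Pi.mul_apply]
      rw [lintegral_subtype_comap measurableSet_Ioi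
        fun y ↦ ENNReal.ofReal (y ^ (Module.finrank ℝ E - 1)) * f y]

/-- Four-dimensional Euclidean space, split into a line and its orthogonal complement. -/
abbrev E4 : Type := WithLp 2 (ℝ × EuclideanSpace ℝ (Fin 3))

/-- The first column of the matrix attached to `q ∈ ℝ⁴`, upper entry. -/
def colFst (q : E4) : ℂ := ⟨q.fst, q.snd 0⟩

/-- The first column of the matrix attached to `q ∈ ℝ⁴`, lower entry. -/
def colSnd (q : E4) : ℂ := ⟨q.snd 1, q.snd 2⟩

/-- The matrix `[[a, -b̄], [b, ā]]` attached to `q = (a, b) ∈ ℂ² = ℝ⁴`. -/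
def quat (q : E4) : Matrix (Fin 2) (Fin 2) ℂ :=
  !![colFst q, -star (colSnd q); colSnd q, star (colFst q)]

theorem norm_sq_eq (q : E4) : ‖q‖ ^ 2 = Complex.normSq (colFst q) + Complex.normSq (colSnd q) := by
  rw [WithLp.prod_norm_sq_eq_of_L2, EuclideanSpace.norm_sq_eq, Fin.sum_univ_three]
  simp [colFst, colSnd, Complex.normSq_apply]
  ring

theorem inner_eq (q n : E4) :
    inner ℝ q n = q.fst * n.fst + (q.snd 0 * n.snd 0 + q.snd 1 * n.snd 1 + q.snd 2 * n.snd 2) := by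
  simp [WithLp.prod_inner_apply, PiLp.inner_apply, Fin.sum_univ_three]
  ring

theorem quat_mul_star (q : E4) : quat q * star (quat q) = ((‖q‖ ^ 2 : ℝ) : ℂ) • 1 := by
  rw [norm_sq_eq]
  ext i j
  fin_cases i <;> fin_cases j <;>
    simp [quat, Matrix.star_eq_conjTranspose, Matrix.mul_apply, Fin.sum_univ_two,
      Complex.normSq_eq_conj_mul_self] <;> ring

/-- Lets left invariance of Haar measure absorb the direction of `q`. -/
theorem exists_unitary_quat {q : E4} (hq : q ≠ 0) :
    ∃ Y : U 2, quat q = (‖q‖ : ℂ) • (Y : Matrix (Fin 2) (Fin 2) ℂ) := by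
  have hn : (‖q‖ : ℂ) ≠ 0 := by simpa using hq
  refine ⟨⟨(‖q‖ : ℂ)⁻¹ • quat q, ?_⟩, ?_⟩
  · rw [Matrix.mem_unitaryGroup_iff, star_smul, smul_mul_smul_comm, quat_mul_star, smul_smul]
    rw [star_inv₀, Complex.star_def, Complex.conj_ofReal]
    push_cast
    rw [show (‖q‖ : ℂ)⁻¹ * (‖q‖ : ℂ)⁻¹ * (‖q‖ : ℂ) ^ 2 = 1 by field_simp, one_smul]
  · simp [smul_smul, hn]

theorem adjugate_eq_det_smul (X : U 2) :
    (X : Matrix (Fin 2) (Fin 2) ℂ).adjugate =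
      (X : Matrix (Fin 2) (Fin 2) ℂ).det • (X : Matrix (Fin 2) (Fin 2) ℂ).conjTranspose := by
  have h := Matrix.mem_unitaryGroup_iff.mp X.2
  rw [Matrix.star_eq_conjTranspose] at h
  calc (X : Matrix (Fin 2) (Fin 2) ℂ).adjugate
      = (X : Matrix (Fin 2) (Fin 2) ℂ).adjugate * (X * (X : Matrix (Fin 2) (Fin 2) ℂ).conjTranspose) := by
        rw [h, mul_one]
    _ = _ := by rw [← mul_assoc, Matrix.adjugate_mul, smul_mul_assoc, one_mul]

theorem norm_det (X : U 2) : ‖(X : Matrix (Fin 2) (Fin 2) ℂ).det‖ = 1 := by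
  have := Matrix.det_of_mem_unitary X.2
  simpa using! CStarRing.norm_of_mem_unitary this

/-- If `v² = det X`, then `v⁻¹ X` lies in `SU(2)`, so it is a unit quaternion. The trace of a
product of two quaternions is twice a real inner product in `ℝ⁴`, and the unimodular `v` does not
affect the modulus. -/
theorem exists_unit_trace (X : U 2) : ∃ n : E4, ‖n‖ = 1 ∧
    ∀ q : E4, ‖(quat q * (X : Matrix (Fin 2) (Fin 2) ℂ)).trace‖ = 2 * |inner ℝ q n| := by
  have hadj := adjugate_eq_det_smul X
  have hd := norm_det X
  have hu := Matrix.mem_unitaryGroup_iff'.mp X.2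
  have h00 := congrFun (congrFun hu 0) 0
  have h1 := congrFun (congrFun hadj 0) 0
  have h2 := congrFun (congrFun hadj 0) 1
  set A : Matrix (Fin 2) (Fin 2) ℂ := X.val with hA
  set d := A.det with hdd
  obtain ⟨v, hv⟩ := IsAlgClosed.exists_pow_nat_eq d two_pos
  have hvn : ‖v‖ = 1 := by
    have : ‖v‖ ^ 2 = 1 := by rw [← norm_pow, hv, hd]
    nlinarith [norm_nonneg v]
  have hvv : v * star v = 1 := by
    rw [Complex.star_def, Complex.mul_conj, Complex.normSq_eq_norm_sq, hvn]; simp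
  simp only [Matrix.adjugate_fin_two, Matrix.smul_apply, Matrix.conjTranspose_apply,
    Matrix.of_apply, Matrix.cons_val_zero, Matrix.cons_val_one, smul_eq_mul, Matrix.cons_val',
    Matrix.cons_val_fin_one] at h1 h2
  simp only [Matrix.star_eq_conjTranspose, Matrix.mul_apply, Fin.sum_univ_two,
    Matrix.conjTranspose_apply, Matrix.one_apply_eq] at h00
  set P := A 0 0 * star v with hP
  set T := A 1 0 * star v with hT
  have hPT : Complex.normSq P + Complex.normSq T = 1 := by
    have hs : Complex.normSq v = 1 := by rw [Complex.normSq_eq_norm_sq, hvn]; norm_num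
    rw [hP, hT]
    simp only [map_mul, Complex.star_def, Complex.normSq_conj, hs, mul_one]
    have := h00
    simp only [Complex.star_def, ← Complex.normSq_eq_conj_mul_self] at this
    exact_mod_cast this
  -- `(P, T)` is the first column of `v⁻¹ X`; the signs turn `Re(aP) - Re(b̄T)`, for `quat q` with
  -- first column `(a, b)`, into `⟨q, n⟩`.
  refine ⟨WithLp.toLp 2 (P.re, WithLp.toLp 2 ![-P.im, -T.re, -T.im]), ?_, ?_⟩
  · have : ‖(WithLp.toLp 2 (P.re, WithLp.toLp 2 ![-P.im, -T.re, -T.im]) : E4)‖ ^ 2 = 1 := by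
      rw [norm_sq_eq, ← hPT]
      simp [colFst, colSnd, Complex.normSq_apply]
    nlinarith [norm_nonneg (WithLp.toLp 2 (P.re, WithLp.toLp 2 ![-P.im, -T.re, -T.im]) : E4)]
  · intro q
    have key : (quat q * A).trace = v * ((2 * inner ℝ q
        (WithLp.toLp 2 (P.re, WithLp.toLp 2 ![-P.im, -T.re, -T.im]) : E4) : ℝ) : ℂ) := by
      have e : ((2 * inner ℝ q
          (WithLp.toLp 2 (P.re, WithLp.toLp 2 ![-P.im, -T.re, -T.im]) : E4) : ℝ) : ℂ) =
          colFst q * P + star (colFst q) * star P - star (colSnd q) * T - colSnd q * star T := by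
        rw [inner_eq]
        apply Complex.ext <;> simp [colFst, colSnd] <;> ring
      rw [e, hP, hT]
      simp only [Matrix.trace_fin_two, quat, Matrix.mul_apply, Fin.sum_univ_two, star_mul', star_star,
        Matrix.of_apply, Matrix.cons_val_zero, Matrix.cons_val_one, Matrix.cons_val',
        Matrix.cons_val_fin_one]
      rw [show A 0 1 = - (d * star (A 1 0)) by rw [← h2]; ring, h1, ← hv]
      linear_combination (colFst q * A 0 0 - star (colSnd q) * A 1 0) * (-hvv)
    rw [key, norm_mul, hvn, one_mul, Complex.norm_real, norm_mul, Real.norm_eq_abs, Real.norm_eq_abs]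
    norm_num

theorem measurable_entry (i j : Fin 2) : Measurable fun X : U 2 => (X : Matrix (Fin 2) (Fin 2) ℂ) i j :=
  Continuous.measurable (continuous_subtype_val.matrix_elem i j)

theorem measurable_trace : Measurable fun X : U 2 => (X : Matrix (Fin 2) (Fin 2) ℂ).trace := by
  simp only [Matrix.trace_fin_two]
  exact (measurable_entry 0 0).add (measurable_entry 1 1)

theorem measurable_det : Measurable fun X : U 2 => (X : Matrix (Fin 2) (Fin 2) ℂ).det := by
  simp only [Matrix.det_fin_two]
  exact ((measurable_entry 0 0).mul (measurable_entry 1 1)).sub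
    ((measurable_entry 0 1).mul (measurable_entry 1 0))

/-- The Gaussian integral over `ℝ⁴` of a function of the cosine of the angle to `n`. -/
noncomputable def gaussAngle (g : ℝ → ℝ≥0∞) (n : E4) : ℝ≥0∞ :=
  ∫⁻ q : E4, ENNReal.ofReal (exp (-‖q‖ ^ 2)) * g (|inner ℝ q n| / ‖q‖)

/-- The reflection exchanging two vectors of equal length is an isometry, hence preserves the
Gaussian. -/
theorem gaussAngle_congr (g : ℝ → ℝ≥0∞) {n m : E4} (h : ‖n‖ = ‖m‖) :
    gaussAngle g n = gaussAngle g m := by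
  unfold gaussAngle
  let R := (ℝ ∙ (n - m))ᗮ.reflection
  have hR : R n = m := Submodule.reflection_sub h
  rw [← R.measurePreserving.lintegral_comp_emb R.toHomeomorph.measurableEmbedding
    fun q => ENNReal.ofReal (exp (-‖q‖ ^ 2)) * g (|inner ℝ q m| / ‖q‖)]
  refine lintegral_congr fun q => ?_
  rw [← hR, R.norm_map, R.inner_map_map]

theorem measurable_colFst : Measurable colFst := by
  have : colFst = fun q : E4 => (q.fst : ℂ) + (q.snd 0 : ℂ) * Complex.I := by
    ext q; apply Complex.ext <;> simp [colFst]
  rw [this]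
  exact Continuous.measurable (by fun_prop)

theorem measurable_colSnd : Measurable colSnd := by
  have : colSnd = fun q : E4 => (q.snd 1 : ℂ) + (q.snd 2 : ℂ) * Complex.I := by
    ext q; apply Complex.ext <;> simp [colSnd]
  rw [this]
  exact Continuous.measurable (by fun_prop)

theorem measurable_trace_quat_mul :
    Measurable fun p : E4 × U 2 => (quat p.1 * (p.2 : Matrix (Fin 2) (Fin 2) ℂ)).trace := by
  have e (i j : Fin 2) : Measurable fun p : E4 × U 2 => (p.2 : Matrix (Fin 2) (Fin 2) ℂ) i j :=
    (measurable_entry i j).comp measurable_snd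
  have f1 : Measurable fun p : E4 × U 2 => colFst p.1 := measurable_colFst.comp measurable_fst
  have f2 : Measurable fun p : E4 × U 2 => colSnd p.1 := measurable_colSnd.comp measurable_fst
  have s1 : Measurable fun p : E4 × U 2 => star (colFst p.1) := continuous_star.measurable.comp f1
  have s2 : Measurable fun p : E4 × U 2 => star (colSnd p.1) := continuous_star.measurable.comp f2
  simp only [Matrix.trace_fin_two, quat, Matrix.mul_apply, Fin.sum_univ_two,
    Matrix.of_apply, Matrix.cons_val_zero, Matrix.cons_val_one, Matrix.cons_val',
    Matrix.cons_val_fin_one]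
  exact ((f1.mul (e 0 0)).add (s2.neg.mul (e 1 0))).add ((f2.mul (e 0 1)).add (s1.mul (e 1 1)))

/-- Tonelli applied to a function of `tr (quat q · X)` in `(q, X)`. For fixed `X` the integral over
`q` is `gaussAngle`, independent of `X` by reflection. For fixed `q ≠ 0`, Haar invariance removes
the unitary part of `quat q`, leaving the integral over `X` alone. -/
theorem lintegral_trace_mul (g : ℝ → ℝ≥0∞) (hg : Measurable g) {n : E4} (hn : ‖n‖ = 1) :
    (∫⁻ q : E4, ENNReal.ofReal (exp (-‖q‖ ^ 2))) *
      ∫⁻ X, g (‖(X : Matrix (Fin 2) (Fin 2) ℂ).trace‖ / 2) ∂(haar 2) = gaussAngle g n := by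
  have hm : Measurable fun p : E4 × U 2 => ENNReal.ofReal (exp (-‖p.1‖ ^ 2)) *
      g (‖(quat p.1 * (p.2 : Matrix (Fin 2) (Fin 2) ℂ)).trace‖ / 2 / ‖p.1‖) := by
    have h := measurable_trace_quat_mul
    fun_prop
  have h1 : ∀ X : U 2, ∫⁻ q : E4, ENNReal.ofReal (exp (-‖q‖ ^ 2)) *
      g (‖(quat q * (X : Matrix (Fin 2) (Fin 2) ℂ)).trace‖ / 2 / ‖q‖) = gaussAngle g n := by
    intro X
    obtain ⟨m, hm1, hm⟩ := exists_unit_trace X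
    rw [gaussAngle_congr g (hn.trans hm1.symm), gaussAngle]
    refine lintegral_congr fun q => ?_
    rw [hm, mul_div_cancel_left₀ _ two_ne_zero]
  have h2 : ∀ᵐ q : E4, ∫⁻ X : U 2, ENNReal.ofReal (exp (-‖q‖ ^ 2)) *
      g (‖(quat q * (X : Matrix (Fin 2) (Fin 2) ℂ)).trace‖ / 2 / ‖q‖) ∂(haar 2) =
      ENNReal.ofReal (exp (-‖q‖ ^ 2)) *
        ∫⁻ X, g (‖(X : Matrix (Fin 2) (Fin 2) ℂ).trace‖ / 2) ∂(haar 2) := by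
    have : ∀ᵐ q : E4, q ≠ 0 := by
      rw [ae_iff]; simp
    filter_upwards [this] with q hq
    rw [lintegral_const_mul' _ _ ENNReal.ofReal_ne_top]
    congr 1
    obtain ⟨Y, hY⟩ := exists_unitary_quat hq
    rw [← lintegral_mul_left_eq_self (fun X : U 2 => g (‖(X : Matrix (Fin 2) (Fin 2) ℂ).trace‖ / 2)) Y]
    refine lintegral_congr fun X => ?_
    have hq' : ‖q‖ ≠ 0 := by simpa using hq
    rw [hY, smul_mul_assoc, Matrix.trace_smul, norm_smul, Complex.norm_real, norm_norm]
    congr 1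
    simp only [Submonoid.coe_mul]
    field_simp
  rw [← lintegral_mul_const _ (by fun_prop), ← lintegral_congr_ae h2,
    lintegral_lintegral_swap hm.aemeasurable]
  simp_rw [h1]
  simp

/-- The Gaussian integral over `ℝ⁴` in terms of the angle to the first axis. -/
theorem gaussAngle_axis : ∃ c : ℝ≥0∞, ∀ g : ℝ → ℝ≥0∞, Measurable g →
    gaussAngle g (WithLp.toLp 2 (1, 0)) =
      c * ∫⁻ θ in Ioo 0 π, ENNReal.ofReal (sin θ ^ 2) * g |cos θ| := by
  -- In `R³`, two powers come from the radial density on `ℝ³` and one from the polar Jacobian in the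
  -- plane.
  refine ⟨(volume : Measure (EuclideanSpace ℝ (Fin 3))).toSphere univ *
    ∫⁻ R in Ioi (0 : ℝ), ENNReal.ofReal (R ^ 3 * exp (-R ^ 2)), fun g hg => ?_⟩
  let F : ℝ × ℝ → ℝ≥0∞ := fun p => ENNReal.ofReal (exp (-√(p.1 ^ 2 + p.2 ^ 2) ^ 2)) *
    g (|p.1| / √(p.1 ^ 2 + p.2 ^ 2))
  have hF : Measurable F := by fun_prop
  -- Truncating with `max ρ 0` extends the half-plane integrand by zero, so that polar coordinates
  -- on the full plane apply; only angles in `(0, π)` then contribute.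
  have hG : Measurable fun p : ℝ × ℝ => ENNReal.ofReal (max p.2 0 ^ 2) * F p := by fun_prop
  have step1 : gaussAngle g (WithLp.toLp 2 (1, 0)) =
      ∫⁻ x : ℝ, ∫⁻ y : EuclideanSpace ℝ (Fin 3), F (x, ‖y‖) := by
    have hF' : Measurable fun p : ℝ × EuclideanSpace ℝ (Fin 3) => F (p.1, ‖p.2‖) := by fun_prop
    rw [← lintegral_prod (fun p : ℝ × EuclideanSpace ℝ (Fin 3) => F (p.1, ‖p.2‖))
      hF'.aemeasurable, gaussAngle, ← (WithLp.volume_preserving_toLp ℝ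
        (EuclideanSpace ℝ (Fin 3))).lintegral_comp_emb
        (MeasurableEquiv.toLp 2 (ℝ × EuclideanSpace ℝ (Fin 3))).measurableEmbedding]
    refine lintegral_congr fun p => ?_
    have hn : ‖(WithLp.toLp 2 p : E4)‖ = √(p.1 ^ 2 + ‖p.2‖ ^ 2) := by
      rw [WithLp.prod_norm_eq_of_L2]; simp
    simp only [F, hn, inner_eq]
    simp
  have step2 : ∀ x : ℝ, ∫⁻ y : EuclideanSpace ℝ (Fin 3), F (x, ‖y‖) =
      (volume : Measure (EuclideanSpace ℝ (Fin 3))).toSphere univ *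
        ∫⁻ ρ : ℝ, ENNReal.ofReal (max ρ 0 ^ 2) * F (x, ρ) := by
    intro x
    rw [lintegral_fun_norm volume (f := fun ρ => F (x, ρ)) (by fun_prop)]
    congr 1
    rw [← lintegral_indicator measurableSet_Ioi]
    refine lintegral_congr fun ρ => ?_
    by_cases h : 0 < ρ
    · simp [h, h.le]
    · simp [h, not_lt.mp h]
  rw [step1]
  simp_rw [step2]
  have hsph : (volume : Measure (EuclideanSpace ℝ (Fin 3))).toSphere univ ≠ ∞ := by
    exact measure_ne_top _ _
  rw [lintegral_const_mul' _ _ hsph, ← lintegral_prod _ hG.aemeasurable, mul_assoc]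
  congr 1
  change ∫⁻ p : ℝ × ℝ, _ = _
  rw [← lintegral_comp_polarCoord_symm, polarCoord_target]
  have hset : ∀ H : ℝ × ℝ → ℝ≥0∞, Measurable H →
      ∫⁻ p in Ioi (0 : ℝ) ×ˢ Ioo (-π) π, H p = ∫⁻ R in Ioi (0 : ℝ), ∫⁻ θ in Ioo (-π) π, H (R, θ) := by
    intro H hH
    rw [Measure.volume_eq_prod, ← Measure.prod_restrict, lintegral_prod _ hH.aemeasurable]
  rw [hset _ (by
    have : Measurable fun p : ℝ × ℝ => polarCoord.symm p := by
      simp only [polarCoord_symm_apply]; fun_prop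
    have := hG.comp this
    have h1 : Measurable fun p : ℝ × ℝ => ENNReal.ofReal p.1 := by fun_prop
    exact h1.mul this)]
  rw [← lintegral_mul_const _ (by fun_prop)]
  refine setLIntegral_congr_fun measurableSet_Ioi fun R (hR : 0 < R) => ?_
  rw [← lintegral_const_mul' _ _ ENNReal.ofReal_ne_top]
  rw [← lintegral_indicator measurableSet_Ioo, ← lintegral_indicator measurableSet_Ioo]
  refine lintegral_congr fun θ => ?_
  have hsq : (R * cos θ) ^ 2 + (R * sin θ) ^ 2 = R ^ 2 := by
    rw [mul_pow, mul_pow, ← mul_add, cos_sq_add_sin_sq, mul_one]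
  simp only [indicator, polarCoord_symm_apply, F, hsq, Real.sqrt_sq hR.le, smul_eq_mul, mem_Ioo]
  by_cases h : 0 < θ ∧ θ < π
  · have hs : 0 < sin θ := sin_pos_of_mem_Ioo h
    rw [if_pos ⟨by linarith [pi_pos], h.2⟩, if_pos h, max_eq_left (by positivity), abs_mul,
      abs_of_pos hR, mul_div_cancel_left₀ _ hR.ne', ← mul_assoc, ← mul_assoc, ← mul_assoc,
      ← ENNReal.ofReal_mul hR.le, ← ENNReal.ofReal_mul (by positivity),
      ← ENNReal.ofReal_mul (by positivity)]
    congr 2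
    ring
  · rw [if_neg h]
    split_ifs with h'
    · have hs : sin θ ≤ 0 := by
        apply sin_nonpos_of_nonpos_of_neg_pi_le _ h'.1.le
        by_contra hc
        exact h ⟨not_le.mp hc, h'.2⟩
      rw [max_eq_right (mul_nonpos_of_nonneg_of_nonpos hR.le hs)]
      simp
    · rfl

/-- The Gaussian integral over `ℝ⁴` is positive and finite. -/
theorem gaussian_ne : (∫⁻ q : E4, ENNReal.ofReal (exp (-‖q‖ ^ 2))) ≠ 0 ∧
    (∫⁻ q : E4, ENNReal.ofReal (exp (-‖q‖ ^ 2))) ≠ ∞ := by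
  constructor
  · rw [Ne, lintegral_eq_zero_iff (by fun_prop)]
    intro h
    have : ∀ᵐ q : E4, False := by
      filter_upwards [h] with q hq
      simp only [Pi.zero_apply, ENNReal.ofReal_eq_zero] at hq
      exact absurd hq (not_le.mpr (exp_pos _))
    simp only [Filter.eventually_false_iff_eq_bot, ae_eq_bot] at this
    exact NeZero.ne (volume : Measure E4) this
  · have h : Integrable fun q : E4 => exp (-‖q‖ ^ 2) := by
      refine (GaussianFourier.integrable_cexp_neg_mul_sq_norm_add (V := E4) (b := 1)
        (by simp) 0 0).norm.congr (Filter.Eventually.of_forall fun q => ?_)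
      simp [Complex.norm_exp, ← Complex.ofReal_pow]
    exact ((hasFiniteIntegral_iff_ofReal (Filter.Eventually.of_forall fun q => (exp_pos _).le)).mp
      h.2).ne

theorem lintegral_sin_sq_Ioo : ∫⁻ θ in Ioo 0 π, ENNReal.ofReal (sin θ ^ 2) = ENNReal.ofReal (π / 2) := by
  rw [← ofReal_integral_eq_lintegral_ofReal]
  · congr 1
    rw [← integral_Ioc_eq_integral_Ioo, ← intervalIntegral.integral_of_le pi_pos.le, integral_sin_sq]
    simp
  · exact (Continuous.integrableOn_Icc (by fun_prop)).mono_set Ioo_subset_Icc_self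
  · exact Filter.Eventually.of_forall fun θ => by positivity

/-- The distribution of the modulus of the trace on `U(2)`. -/
theorem lintegral_trace (g : ℝ → ℝ≥0∞) (hg : Measurable g) :
    ∫⁻ X, g (‖(X : Matrix (Fin 2) (Fin 2) ℂ).trace‖ / 2) ∂(haar 2) =
      ENNReal.ofReal (2 / π) * ∫⁻ θ in Ioo 0 π, ENNReal.ofReal (sin θ ^ 2) * g |cos θ| := by
  obtain ⟨c, hc⟩ := gaussAngle_axis
  obtain ⟨h0, h1⟩ := gaussian_ne
  have hn : ‖(WithLp.toLp 2 (1, 0) : E4)‖ = 1 := by rw [WithLp.prod_norm_eq_of_L2]; simp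
  have key := fun (g : ℝ → ℝ≥0∞) hg => (lintegral_trace_mul g hg hn).trans (hc g hg)
  set W := ∫⁻ q : E4, ENNReal.ofReal (exp (-‖q‖ ^ 2))
  -- The test function `g = 1` calibrates the constant, Haar measure having mass one.
  have hW : W = c * ENNReal.ofReal (π / 2) := by
    simpa [lintegral_sin_sq_Ioo] using key 1 measurable_one
  have hcW : c = W * ENNReal.ofReal (2 / π) := by
    rw [hW, mul_assoc, ← ENNReal.ofReal_mul (by positivity)]
    rw [show π / 2 * (2 / π) = 1 by field_simp]
    simp
  have := key g hg
  rw [hcW, mul_assoc] at this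
  exact (ENNReal.mul_right_inj h0 h1).mp this

end UnitaryLog

/-! ### Power series of `arcsin` and of the hypergeometric function. -/

namespace UnitaryLog

theorem rising_succ (a : ℝ) (n : ℕ) : rising a (n + 1) = rising a n * (a + n) :=
  Finset.prod_range_succ _ _

theorem rising_eq_eval (a : ℝ) (n : ℕ) : rising a n = (ascPochhammer ℝ n).eval a := by
  induction n with
  | zero => simp [rising]
  | succ n ih => rw [rising_succ, ih, ascPochhammer_succ_eval]

/-- The Taylor coefficients `(1/2)_n / n!` of `(1 - x)^(-1/2)`. -/
noncomputable def invSqrtCoeff (n : ℕ) : ℝ := rising (1 / 2) n / n.factorial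

theorem invSqrtCoeff_succ (n : ℕ) :
    invSqrtCoeff (n + 1) = invSqrtCoeff n * ((1 / 2 + n) / (n + 1)) := by
  rw [invSqrtCoeff, invSqrtCoeff, rising_succ, Nat.factorial_succ]
  push_cast
  have : (n.factorial : ℝ) ≠ 0 := by positivity
  field_simp

theorem invSqrtCoeff_mem (n : ℕ) : 0 ≤ invSqrtCoeff n ∧ invSqrtCoeff n ≤ 1 := by
  induction n with
  | zero => simp [invSqrtCoeff, rising]
  | succ n ih =>
    rw [invSqrtCoeff_succ]
    refine ⟨mul_nonneg ih.1 (by positivity), mul_le_one₀ ih.2 (by positivity) ?_⟩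
    rw [div_le_one (by positivity)]
    linarith

/-- The binomial series of exponent `-1/2` at `-x²`; the sign from the negative exponent cancels the
one from `(-x²)ⁿ`. -/
theorem hasSum_invSqrtCoeff {x : ℝ} (hx : |x| < 1) :
    HasSum (fun n => invSqrtCoeff n * x ^ (2 * n)) (1 / √(1 - x ^ 2)) := by
  have hx2 : x ^ 2 < 1 := by rwa [sq_lt_one_iff_abs_lt_one]
  have h := (Real.one_add_rpow_hasFPowerSeriesOnBall_zero (a := -(1 / 2))).hasSum (y := -x ^ 2) (by
    simp only [Metric.mem_eball, edist_zero_right]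
    rw [← ofReal_norm, ENNReal.ofReal_lt_one]
    simpa using hx2)
  have hf : (fun n => invSqrtCoeff n * x ^ (2 * n)) =
      fun n => (binomialSeries ℝ (-(1 / 2) : ℝ) n) fun _ => -x ^ 2 := by
    funext n
    rw [binomialSeries_apply, Ring.choose_neg, ← Ring.multichoose_eq]
    have hm : Ring.multichoose (1 / 2 : ℝ) n = invSqrtCoeff n := by
      have := Ring.factorial_nsmul_multichoose_eq_ascPochhammer (1 / 2 : ℝ) n
      rw [Polynomial.ascPochhammer_smeval_eq_eval, ← rising_eq_eval, nsmul_eq_mul] at this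
      rw [invSqrtCoeff, ← this]
      field_simp
    rw [hm]
    simp only [List.ofFn_const, List.prod_replicate, smul_eq_mul, Units.smul_def, zsmul_eq_mul]
    rw [neg_pow, ← pow_mul]
    have : ((-1 : ℝ) ^ n) * (-1) ^ n = 1 := by rw [← mul_pow]; simp
    have hn : (((n : ℤ).negOnePow : ℤ) : ℝ) = (-1) ^ n := by
      rw [Int.negOnePow_def, zpow_natCast]; push_cast; rfl
    rw [hn]
    linear_combination (-invSqrtCoeff n * x ^ (2 * n)) * this
  have hv : 1 / √(1 - x ^ 2) = (1 + (0 + -x ^ 2)) ^ (-(1 / 2) : ℝ) := by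
    rw [zero_add, ← sub_eq_add_neg, rpow_neg (by linarith), ← sqrt_eq_rpow, one_div]
  rw [hf, hv]
  exact h

theorem summable_mul_pow {b : ℕ → ℝ} (hb : ∀ n, |b n| ≤ 1) {x : ℝ} (hx : |x| < 1) :
    Summable fun n => b n * x ^ (2 * n) := by
  refine Summable.of_norm_bounded (g := fun n => (x ^ 2) ^ n)
    (summable_geometric_of_lt_one (sq_nonneg x) (by rwa [sq_lt_one_iff_abs_lt_one])) fun n => ?_
  rw [norm_mul, pow_mul, norm_of_nonneg (pow_nonneg (sq_nonneg x) n)]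
  exact mul_le_of_le_one_left (by positivity) (hb n)

theorem hasDerivAt_tsum_odd {b : ℕ → ℝ} (hb : ∀ n, |b n| ≤ 1) {x : ℝ} (hx : |x| < 1) :
    HasDerivAt (fun y => ∑' n : ℕ, b n / (2 * n + 1) * y ^ (2 * n + 1))
      (∑' n : ℕ, b n * x ^ (2 * n)) x := by
  -- On the smaller interval `(-ρ, ρ)` the differentiated series has the uniform geometric majorant
  -- `ρ^(2n)`.
  obtain ⟨ρ, hxρ, hρ1⟩ := exists_between hx
  have hρ0 : 0 ≤ ρ := (abs_nonneg x).trans hxρ.le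
  refine hasDerivAt_tsum_of_isPreconnected (u := fun n => (ρ ^ 2) ^ n) (t := Ioo (-ρ) ρ) (y₀ := 0)
    (summable_geometric_of_lt_one (sq_nonneg ρ) (by nlinarith)) isOpen_Ioo isPreconnected_Ioo
    (g := fun n y => b n / (2 * n + 1) * y ^ (2 * n + 1)) (g' := fun n y => b n * y ^ (2 * n))
    ?_ ?_ ?_ ?_ ?_
  · intro n y _
    refine ((hasDerivAt_pow (2 * n + 1) y).const_mul (b n / (2 * n + 1))).congr_deriv ?_
    push_cast
    have : (2 * (n : ℝ) + 1) ≠ 0 := by positivity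
    rw [← mul_assoc, div_mul_cancel₀ _ this]
  · intro n y hy
    rw [norm_mul, pow_mul, norm_pow]
    have hy' : |y| ≤ ρ := (abs_lt.mpr hy).le
    have : ‖y ^ 2‖ ≤ ρ ^ 2 := by
      rw [norm_pow]
      exact pow_le_pow_left₀ (norm_nonneg _) hy' 2
    calc ‖b n‖ * ‖y ^ 2‖ ^ n ≤ 1 * (ρ ^ 2) ^ n := by
          gcongr
          exact hb n
      _ = _ := one_mul _
  · exact ⟨by linarith [(abs_nonneg x).trans_lt hxρ], (abs_nonneg x).trans_lt hxρ⟩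
  · simp
  · exact abs_lt.mp hxρ

theorem abs_div_odd_le {b : ℕ → ℝ} (hb : ∀ n, |b n| ≤ 1) (n : ℕ) : |b n / (2 * n + 1)| ≤ 1 := by
  rw [abs_div, abs_of_pos (by positivity : (0 : ℝ) < 2 * n + 1)]
  exact div_le_one_of_le₀ ((hb n).trans (by linarith [n.cast_nonneg (α := ℝ)])) (by positivity)

theorem abs_invSqrtCoeff_le (n : ℕ) : |invSqrtCoeff n| ≤ 1 := by
  rw [abs_of_nonneg (invSqrtCoeff_mem n).1]; exact (invSqrtCoeff_mem n).2

theorem arcsin_eq_tsum {x : ℝ} (hx : |x| < 1) :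
    arcsin x = ∑' n : ℕ, invSqrtCoeff n / (2 * n + 1) * x ^ (2 * n + 1) := by
  have hd : ∀ y ∈ Ioo (-1 : ℝ) 1, HasDerivAt
      (fun y => ∑' n : ℕ, invSqrtCoeff n / (2 * n + 1) * y ^ (2 * n + 1)) (1 / √(1 - y ^ 2)) y := by
    intro y hy
    have hy' : |y| < 1 := abs_lt.mpr hy
    rw [← (hasSum_invSqrtCoeff hy').tsum_eq]
    exact hasDerivAt_tsum_odd abs_invSqrtCoeff_le hy'
  have ha : ∀ y ∈ Ioo (-1 : ℝ) 1, HasDerivAt arcsin (1 / √(1 - y ^ 2)) y := fun y hy =>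
    hasDerivAt_arcsin (by linarith [hy.1]) (by linarith [hy.2])
  refine isOpen_Ioo.eqOn_of_deriv_eq isPreconnected_Ioo
    (fun y hy => (ha y hy).differentiableAt.differentiableWithinAt)
    (fun y hy => (hd y hy).differentiableAt.differentiableWithinAt)
    (fun y hy => (ha y hy).deriv.trans (hd y hy).deriv.symm) (x := 0) (by norm_num) (by simp)
    (abs_lt.mp hx)

/-- The function `x · ₃F₂(1/2, 1/2, 1/2; 3/2, 3/2; x²)`, as a power series. -/
noncomputable def arcsinInt (x : ℝ) : ℝ :=
  ∑' n : ℕ, invSqrtCoeff n / (2 * n + 1) / (2 * n + 1) * x ^ (2 * n + 1)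

/-- At `x = 0` the derivative is 1, while the quotient is 0 by the division convention, so that
point is excluded. -/
theorem hasDerivAt_arcsinInt {x : ℝ} (hx : |x| < 1) (hx0 : x ≠ 0) :
    HasDerivAt arcsinInt (arcsin x / x) x := by
  convert! hasDerivAt_tsum_odd (abs_div_odd_le abs_invSqrtCoeff_le) hx using 1
  rw [arcsin_eq_tsum hx, ← tsum_div_const]
  refine tsum_congr fun n => ?_
  rw [pow_succ]
  field_simp

theorem continuousAt_arcsinInt {x : ℝ} (hx : |x| < 1) : ContinuousAt arcsinInt x :=
  (hasDerivAt_tsum_odd (abs_div_odd_le abs_invSqrtCoeff_le) hx).continuousAt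

/-- Shifting the parameter by one telescopes the product. Each of the two such quotients in `₃F₂`
supplies one factor `1/(2n+1)`. -/
theorem rising_half_div (n : ℕ) : rising (1 / 2) n / rising (3 / 2) n = 1 / (2 * n + 1) := by
  have h : ∀ n, rising (1 / 2) n * (2 * n + 1) = rising (3 / 2) n := by
    intro n
    induction n with
    | zero => simp [rising]
    | succ n ih =>
      rw [rising_succ, rising_succ, ← ih]
      push_cast
      ring
  have hp : 0 < rising (1 / 2) n := Finset.prod_pos fun i _ => by positivity
  rw [← h]
  field_simp

theorem hyp32Term_eq (r : ℝ) (n : ℕ) :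
    hyp32Term (1 / 2) (1 / 2) (1 / 2) (3 / 2) (3 / 2) (r ^ 2) n =
      invSqrtCoeff n / (2 * n + 1) / (2 * n + 1) * r ^ (2 * n) := by
  have : hyp32Term (1 / 2) (1 / 2) (1 / 2) (3 / 2) (3 / 2) (r ^ 2) n =
      rising (1 / 2) n / n.factorial * (rising (1 / 2) n / rising (3 / 2) n) *
        (rising (1 / 2) n / rising (3 / 2) n) * (r ^ 2) ^ n := by
    rw [hyp32Term]; ring
  rw [this, rising_half_div, invSqrtCoeff, ← pow_mul]
  ring

theorem summable_hyp32Term {r : ℝ} (hr : |r| < 1) :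
    Summable (hyp32Term (1 / 2) (1 / 2) (1 / 2) (3 / 2) (3 / 2) (r ^ 2)) := by
  refine (summable_mul_pow (abs_div_odd_le (abs_div_odd_le abs_invSqrtCoeff_le)) hr).congr fun n => ?_
  rw [hyp32Term_eq]

theorem mul_hyp32_eq (r : ℝ) :
    r * hyp32 (1 / 2) (1 / 2) (1 / 2) (3 / 2) (3 / 2) (r ^ 2) = arcsinInt r := by
  rw [hyp32, arcsinInt, ← tsum_mul_left]
  refine tsum_congr fun n => ?_
  rw [hyp32Term_eq, pow_succ]
  ring

/-! ### Log-sine integrals. -/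

theorem continuousOn_mul_log_sin : ContinuousOn (fun x => x * log (sin x)) (Ico 0 π) := by
  have hs : ∀ x ∈ Ico 0 π, sinc x ≠ 0 := by
    intro x hx
    rcases eq_or_ne x 0 with rfl | h
    · simp
    · rw [sinc_of_ne_zero h]
      exact div_ne_zero (sin_pos_of_pos_of_lt_pi (lt_of_le_of_ne hx.1 h.symm) hx.2).ne' h
  -- Dividing out `x` leaves `log (sinc x)`, which is regular at 0; the singular part `x log x` is
  -- continuous.
  have : ContinuousOn (fun x => x * log x + x * log (sinc x)) (Ico 0 π) :=
    continuous_mul_log.continuousOn.add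
      (continuousOn_id.mul (continuous_sinc.continuousOn.log hs))
  refine this.congr fun x hx => ?_
  rcases eq_or_ne x 0 with rfl | h
  · simp
  · have := hs x hx
    simp only
    rw [← mul_add, ← log_mul h this, sinc_of_ne_zero h, mul_div_cancel₀ _ h]

/-- The value of `∫ φ cot φ` over `[0, a]`, after integration by parts. -/
theorem arcsinInt_sin {a : ℝ} (h0 : 0 ≤ a) (h1 : a < π / 2) :
    arcsinInt (sin a) = a * log (sin a) - ∫ x in (0)..a, log (sin x) := by
  have hpi := pi_pos
  have hint : ∀ b c, IntervalIntegrable (fun x => log (sin x)) volume b c :=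
    fun b c => intervalIntegrable_log_sin
  have hsin : ∀ x ∈ Ico 0 a, |sin x| < 1 ∧ (0 < x → 0 < sin x) := by
    intro x hx
    have hc : 0 < cos x := cos_pos_of_mem_Ioo ⟨by linarith [hx.1], by linarith [hx.2]⟩
    refine ⟨?_, fun h => sin_pos_of_pos_of_lt_pi h (by linarith [hx.2])⟩
    rw [← sq_lt_one_iff_abs_lt_one]
    nlinarith [sin_sq_add_cos_sq x]
  have hsina : |sin a| < 1 := by
    have hc : 0 < cos a := cos_pos_of_mem_Ioo ⟨by linarith, by linarith⟩
    rw [← sq_lt_one_iff_abs_lt_one]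
    nlinarith [sin_sq_add_cos_sq a]
  -- This is a primitive of `log sin`: differentiating `arcsinInt ∘ sin` gives `x cot x`, which
  -- cancels the same term from the product rule. Continuity suffices at 0, where `log sin` is
  -- singular.
  have hcont : ContinuousOn (fun x => x * log (sin x) - arcsinInt (sin x)) (Icc 0 a) := by
    refine (continuousOn_mul_log_sin.mono fun x hx => ⟨hx.1, by linarith [hx.2]⟩).sub ?_
    intro x hx
    have hx1 : |sin x| < 1 := by
      rcases eq_or_lt_of_le hx.2 with h | h
      · rw [h]; exact hsina
      · exact (hsin x ⟨hx.1, h⟩).1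
    exact ((continuousAt_arcsinInt hx1).comp continuous_sin.continuousAt).continuousWithinAt
  have hderiv : ∀ x ∈ Ioo 0 a, HasDerivAt (fun x => x * log (sin x) - arcsinInt (sin x))
      (log (sin x)) x := by
    intro x hx
    obtain ⟨hx1, hx2⟩ := hsin x ⟨hx.1.le, hx.2⟩
    have hs := hx2 hx.1
    have e := ((hasDerivAt_id x).mul ((hasDerivAt_sin x).log hs.ne')).sub
      ((hasDerivAt_arcsinInt hx1 hs.ne').comp x (hasDerivAt_sin x))
    refine e.congr_deriv ?_
    rw [arcsin_sin (by linarith [hx.1]) (by linarith [hx.2])]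
    simp only [id]
    field_simp
    ring
  have := intervalIntegral.integral_eq_sub_of_hasDerivAt_of_le h0 hcont hderiv (hint 0 a)
  rw [this]
  simp [arcsinInt]

/-- The derivative of `cos x · sin x · log(sin x) / 2` is `cos² x · log(sin x) - log(sin x)/2 + cos²
x / 2`. Grouped as `sin · log sin`, this primitive is continuous even at `a = 0`. -/
theorem integral_cos_sq_mul_log_sin {a : ℝ} (h0 : 0 ≤ a) (h1 : a < π / 2) :
    ∫ x in a..(π / 2), cos x ^ 2 * log (sin x) =
      (1 / 2) * (∫ x in a..(π / 2), log (sin x)) - (1 / 2) * (∫ x in a..(π / 2), cos x ^ 2) -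
        sin a * cos a * log (sin a) / 2 := by
  have hpi := pi_pos
  have hint : IntervalIntegrable (fun x => log (sin x)) volume a (π / 2) := intervalIntegrable_log_sin
  have hc2 : IntervalIntegrable (fun x => cos x ^ 2) volume a (π / 2) :=
    Continuous.intervalIntegrable (by fun_prop) _ _
  have hm : IntervalIntegrable (fun x => cos x ^ 2 * log (sin x)) volume a (π / 2) :=
    hint.continuousOn_mul (by fun_prop)
  have hcont : Continuous fun x => cos x * (sin x * log (sin x)) / 2 :=
    (continuous_cos.mul (continuous_mul_log.comp continuous_sin)).div_const 2
  have := intervalIntegral.integral_eq_sub_of_hasDerivAt_of_le h1.le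
    (f := fun x => cos x * (sin x * log (sin x)) / 2)
    (f' := fun x => cos x ^ 2 * log (sin x) - (1 / 2) * log (sin x) + (1 / 2) * cos x ^ 2)
    hcont.continuousOn (fun x hx => ?_) ((hm.sub (hint.const_mul _)).add (hc2.const_mul _))
  · rw [intervalIntegral.integral_add (hm.sub (hint.const_mul _)) (hc2.const_mul _),
      intervalIntegral.integral_sub hm (hint.const_mul _), intervalIntegral.integral_const_mul,
      intervalIntegral.integral_const_mul] at this
    simp only [cos_pi_div_two, zero_mul, zero_div] at this
    linarith
  · have hs : 0 < sin x := sin_pos_of_pos_of_lt_pi (by linarith [hx.1]) (by linarith [hx.2])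
    have e := ((hasDerivAt_cos x).mul ((hasDerivAt_sin x).mul
      ((hasDerivAt_sin x).log hs.ne'))).div_const 2
    refine e.congr_deriv ?_
    simp only [Pi.mul_apply]
    field_simp
    rw [sin_sq]
    ring

theorem intervalIntegrable_cos_sq_mul_log_max {r : ℝ} (hr : 0 ≤ r) (a b : ℝ) :
    IntervalIntegrable (fun x => cos x ^ 2 * log (max r |sin x|)) volume a b := by
  refine IntervalIntegrable.continuousOn_mul ?_ (by fun_prop)
  rcases hr.eq_or_lt with rfl | h
  · simpa using! (intervalIntegrable_log_sin (a := a) (b := b))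
  · refine Continuous.intervalIntegrable (Continuous.log (by fun_prop) fun x => ?_) _ _
    exact (h.trans_le (le_max_left _ _)).ne'

/-- The maximum is `sin a` up to `x = a` and `sin x` beyond. The terms in `sin a · cos a · log(sin
a)` from the two pieces cancel; the remaining `a · log(sin a)` and log-sine integral combine into
`arcsinInt` and Euler's constant term `-(π/2) log 2`. -/
theorem integral_cos_sq_mul_log_max {a : ℝ} (h0 : 0 ≤ a) (h1 : a < π / 2) :
    ∫ x in (0)..(π / 2), cos x ^ 2 * log (max (sin a) |sin x|) =
      (arcsinInt (sin a) - π / 2 * log 2 - π / 4 + (a + sin a * cos a) / 2) / 2 := by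
  have hpi := pi_pos
  have hsa : 0 ≤ sin a := sin_nonneg_of_nonneg_of_le_pi h0 (by linarith)
  have hi := intervalIntegrable_cos_sq_mul_log_max hsa
  have hls : ∀ b c, IntervalIntegrable (fun x => log (sin x)) volume b c :=
    fun b c => intervalIntegrable_log_sin
  rw [← intervalIntegral.integral_add_adjacent_intervals (hi 0 a) (hi a (π / 2))]
  have e1 : ∫ x in (0)..a, cos x ^ 2 * log (max (sin a) |sin x|) =
      ∫ x in (0)..a, cos x ^ 2 * log (sin a) := by
    refine intervalIntegral.integral_congr fun x hx => ?_
    rw [uIcc_of_le h0] at hx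
    have hx0 : 0 ≤ sin x := sin_nonneg_of_nonneg_of_le_pi hx.1 (by linarith [hx.2])
    simp only [abs_of_nonneg hx0]
    rw [max_eq_left (sin_le_sin_of_le_of_le_pi_div_two (by linarith [hx.1]) h1.le hx.2)]
  have e2 : ∫ x in a..(π / 2), cos x ^ 2 * log (max (sin a) |sin x|) =
      ∫ x in a..(π / 2), cos x ^ 2 * log (sin x) := by
    refine intervalIntegral.integral_congr fun x hx => ?_
    rw [uIcc_of_le h1.le] at hx
    have hx0 : 0 ≤ sin x := sin_nonneg_of_nonneg_of_le_pi (by linarith [hx.1]) (by linarith [hx.2])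
    simp only [abs_of_nonneg hx0]
    rw [max_eq_right (sin_le_sin_of_le_of_le_pi_div_two (by linarith) hx.2 hx.1)]
  have e3 := intervalIntegral.integral_add_adjacent_intervals (hls 0 a) (hls a (π / 2))
  rw [integral_log_sin_zero_pi_div_two] at e3
  rw [e1, e2, intervalIntegral.integral_mul_const, integral_cos_sq_mul_log_sin h0 h1,
    integral_cos_sq, integral_cos_sq, arcsinInt_sin h0 h1]
  simp only [cos_pi_div_two, sin_zero, cos_zero]
  linear_combination (1 / 2) * e3

theorem intervalIntegral_sin_sq_eq {r : ℝ} (hr : 0 ≤ r) :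
    ∫ x in (0)..π, sin x ^ 2 * log (max r |cos x|) =
      2 * ∫ x in (0)..(π / 2), cos x ^ 2 * log (max r |sin x|) := by
  have hi := intervalIntegrable_cos_sq_mul_log_max hr
  have e1 : ∫ x in (0)..π, sin x ^ 2 * log (max r |cos x|) =
      ∫ x in (-(π / 2))..(π / 2), cos x ^ 2 * log (max r |sin x|) := by
    have := intervalIntegral.integral_comp_sub_right (a := 0) (b := π)
      (fun x => cos x ^ 2 * log (max r |sin x|)) (π / 2)
    simp only [cos_sub_pi_div_two, sin_sub_pi_div_two, abs_neg] at this
    rw [this]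
    congr 1 <;> ring
  have e2 : ∫ x in (-(π / 2))..0, cos x ^ 2 * log (max r |sin x|) =
      ∫ x in (0)..(π / 2), cos x ^ 2 * log (max r |sin x|) := by
    have := intervalIntegral.integral_comp_neg (a := 0) (b := π / 2)
      (fun x => cos x ^ 2 * log (max r |sin x|))
    simp only [cos_neg, sin_neg, abs_neg, neg_zero] at this
    exact this.symm
  rw [e1, ← intervalIntegral.integral_add_adjacent_intervals (hi _ 0) (hi 0 _), e2, two_mul]

theorem integrableOn_sin_sq_mul_log_max {r : ℝ} (hr : 0 ≤ r) :
    IntegrableOn (fun x => sin x ^ 2 * log (max r |cos x|)) (Ioo 0 π) := by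
  have h := (intervalIntegrable_cos_sq_mul_log_max hr (-(π / 2)) (π / 2)).comp_sub_right (π / 2)
  simp only [cos_sub_pi_div_two, sin_sub_pi_div_two, abs_neg, neg_add_cancel, add_halves] at h
  exact ((intervalIntegrable_iff_integrableOn_Ioc_of_le pi_pos.le).mp h).mono_set Ioo_subset_Ioc_self

theorem integral_sin_sq_mul_log_max {r : ℝ} (hr0 : 0 ≤ r) (hr1 : r < 1) :
    ∫ x in Ioo 0 π, sin x ^ 2 * log (max r |cos x|) =
      arcsinInt r - π / 2 * log 2 - π / 4 + (arcsin r + r * √(1 - r ^ 2)) / 2 := by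
  rw [← integral_Ioc_eq_integral_Ioo, ← intervalIntegral.integral_of_le pi_pos.le,
    intervalIntegral_sin_sq_eq hr0]
  have h := integral_cos_sq_mul_log_max (arcsin_nonneg.mpr hr0) (arcsin_lt_pi_div_two.mpr hr1)
  rw [sin_arcsin (by linarith) hr1.le, cos_arcsin] at h
  rw [h]
  ring

end UnitaryLog

/-! ### Transfer to `U(2)` and averaging over the phase. -/

namespace UnitaryLog

/-- The law of `|tr X| / 2` on `U(2)` is the law of `|cos θ|` under `(2/π) sin² θ dθ` on `(0, π)`. -/
theorem map_trace : (haar 2).map (fun X : U 2 => ‖(X : Matrix (Fin 2) (Fin 2) ℂ).trace‖ / 2) =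
    ENNReal.ofReal (2 / π) • ((volume.restrict (Ioo 0 π)).withDensity
      fun θ => ENNReal.ofReal (sin θ ^ 2)).map fun θ => |cos θ| := by
  have ht : Measurable fun X : U 2 => ‖(X : Matrix (Fin 2) (Fin 2) ℂ).trace‖ / 2 :=
    measurable_trace.norm.div_const 2
  refine Measure.ext_of_lintegral _ fun g hg => ?_
  rw [lintegral_map hg ht, lintegral_trace g hg, lintegral_smul_measure, lintegral_map hg (by fun_prop),
    lintegral_withDensity_eq_lintegral_mul _ (by fun_prop) (by fun_prop)]
  rfl

theorem integrable_comp_trace {g : ℝ → ℝ} (hg : Measurable g)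
    (hi : IntegrableOn (fun θ => sin θ ^ 2 * g |cos θ|) (Ioo 0 π)) :
    Integrable (fun X : U 2 => g (‖(X : Matrix (Fin 2) (Fin 2) ℂ).trace‖ / 2)) (haar 2) := by
  have ht : Measurable fun X : U 2 => ‖(X : Matrix (Fin 2) (Fin 2) ℂ).trace‖ / 2 :=
    measurable_trace.norm.div_const 2
  change Integrable (g ∘ fun X : U 2 => ‖(X : Matrix (Fin 2) (Fin 2) ℂ).trace‖ / 2) (haar 2)
  rw [← integrable_map_measure hg.aestronglyMeasurable ht.aemeasurable, map_trace]
  refine Integrable.smul_measure ?_ ENNReal.ofReal_ne_top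
  rw [integrable_map_measure hg.aestronglyMeasurable (by fun_prop),
    integrable_withDensity_iff_integrable_smul' (by fun_prop) (by simp)]
  refine hi.congr (Filter.Eventually.of_forall fun θ => ?_)
  simp [ENNReal.toReal_ofReal (sq_nonneg (sin θ))]

theorem integral_comp_trace {g : ℝ → ℝ} (hg : Measurable g) :
    ∫ X : U 2, g (‖(X : Matrix (Fin 2) (Fin 2) ℂ).trace‖ / 2) ∂(haar 2) =
      2 / π * ∫ θ in Ioo 0 π, sin θ ^ 2 * g |cos θ| := by
  have ht : Measurable fun X : U 2 => ‖(X : Matrix (Fin 2) (Fin 2) ℂ).trace‖ / 2 :=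
    measurable_trace.norm.div_const 2
  rw [← integral_map (f := g) ht.aemeasurable hg.aestronglyMeasurable, map_trace,
    integral_smul_measure, integral_map (by fun_prop) hg.aestronglyMeasurable,
    integral_withDensity_eq_integral_toReal_smul (by fun_prop) (by simp),
    ENNReal.toReal_ofReal (by positivity), smul_eq_mul]
  congr 1
  refine integral_congr_ae (Filter.Eventually.of_forall fun θ => ?_)
  simp [ENNReal.toReal_ofReal (sq_nonneg (sin θ))]

/-- The quotient of the conjugates of the trace and of the determinant. -/
noncomputable def traceDivDet (X : U 2) : ℂ :=
  star (X : Matrix (Fin 2) (Fin 2) ℂ).trace / star (X : Matrix (Fin 2) (Fin 2) ℂ).det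

theorem norm_traceDivDet (X : U 2) :
    ‖traceDivDet X‖ = ‖(X : Matrix (Fin 2) (Fin 2) ℂ).trace‖ := by
  rw [traceDivDet, norm_div, norm_star, norm_star, norm_det, div_one]

theorem measurable_traceDivDet : Measurable traceDivDet :=
  (continuous_star.measurable.comp measurable_trace).div
    (continuous_star.measurable.comp measurable_det)

theorem norm_traceDivDet_le (X : U 2) : ‖traceDivDet X‖ ≤ 2 := by
  rw [norm_traceDivDet, Matrix.trace_fin_two]
  refine (norm_add_le _ _).trans ?_
  linarith [entry_norm_bound_of_unitary X.2 0 0, entry_norm_bound_of_unitary X.2 1 1]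

/-- Differentiate the quadratic `Λ_X` and divide by the unimodular `conj(det X)`. -/
theorem norm_deriv_Λ (X : U 2) (r : ℝ) :
    ‖deriv (Λ X) (r : ℂ)‖ = ‖((2 * r : ℝ) : ℂ) - traceDivDet X‖ := by
  set A : Matrix (Fin 2) (Fin 2) ℂ := X.val with hA
  have hd : ‖star A.det‖ = 1 := by rw [norm_star]; exact norm_det X
  have hΛ : Λ X = fun s => 1 - s * star A.trace + s ^ 2 * star A.det := by
    ext s
    simp only [Λ, Matrix.det_fin_two, Matrix.trace_fin_two, Matrix.sub_apply, Matrix.smul_apply,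
      Matrix.conjTranspose_apply, smul_eq_mul, star_sub, star_mul', star_add, ← hA]
    simp
    ring
  have hderiv : HasDerivAt (Λ X) (-star A.trace + 2 * r * star A.det) (r : ℂ) := by
    rw [hΛ]
    have h := (((hasDerivAt_const (r : ℂ) (1 : ℂ)).sub
      ((hasDerivAt_id (r : ℂ)).mul_const (star A.trace))).add
      ((hasDerivAt_pow 2 (r : ℂ)).mul_const (star A.det)))
    refine h.congr_deriv ?_
    simp
  have h0 : star A.det ≠ 0 := by
    intro h; rw [h] at hd; simp at hd
  rw [hderiv.deriv, traceDivDet, ← hA, ← mul_one ‖_ - _‖, ← hd, ← norm_mul]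
  congr 1
  push_cast
  field_simp
  ring

/-- The scalar unitary matrix `e^{-iφ}`. -/
noncomputable def phase (φ : ℝ) : U 2 :=
  ⟨Complex.exp (-(φ * Complex.I)) • 1, by
    rw [Matrix.mem_unitaryGroup_iff, star_smul, star_one, smul_mul_smul_comm, one_mul,
      Complex.star_def, ← Complex.exp_conj, ← Complex.exp_add]
    simp⟩

theorem traceDivDet_phase_mul (φ : ℝ) (X : U 2) :
    traceDivDet (phase φ * X) = Complex.exp (-(φ * Complex.I)) * traceDivDet X := by
  have h0 := Complex.exp_ne_zero (φ * Complex.I)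
  simp only [traceDivDet, phase, Submonoid.coe_mul, smul_mul_assoc, one_mul, Matrix.trace_smul,
    Matrix.det_smul, Fintype.card_fin, smul_eq_mul, star_mul', star_pow]
  have : star (Complex.exp (-(φ * Complex.I))) = Complex.exp (φ * Complex.I) := by
    rw [Complex.star_def, ← Complex.exp_conj]; simp
  rw [this, Complex.exp_neg]
  field_simp

/-- Multiplying by `e^{iφ}` moves the rotation from `z` to `R`, which then runs over the circle of
Jensen's formula. -/
theorem norm_sub_traceDivDet_phase_mul (φ R : ℝ) (X : U 2) :
    ‖(R : ℂ) - traceDivDet (phase φ * X)‖ = ‖circleMap 0 R φ - traceDivDet X‖ := by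
  have h : ‖Complex.exp (φ * Complex.I)‖ = 1 := Complex.norm_exp_ofReal_mul_I φ
  rw [traceDivDet_phase_mul, ← one_mul ‖(R : ℂ) - _‖, ← h, ← norm_mul, mul_sub, ← mul_assoc,
    ← Complex.exp_add]
  simp [circleMap, mul_comm]

/-- Jensen's formula for a linear polynomial; the degenerate circle `R = 0` is treated directly. -/
theorem circleAverage_log_norm_sub {R : ℝ} (hR : 0 ≤ R) (a : ℂ) :
    circleAverage (fun z => log ‖z - a‖) 0 R = log (max R ‖a‖) := by
  rcases hR.eq_or_lt with rfl | h
  · simp [circleAverage_zero]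
  · rw [circleAverage_log_norm_sub_const_eq_log_radius_add_posLog h.ne',
      posLog_eq_log_max_one (by positivity), zero_sub, norm_neg, ← log_mul h.ne' (by positivity),
      mul_max_of_nonneg _ _ h.le, mul_one, mul_inv_cancel_left₀ h.ne']

theorem log_le_log_four {x : ℝ} (h0 : 0 ≤ x) (h : x ≤ 4) : log x ≤ log 4 := by
  rcases h0.eq_or_lt with rfl | h0
  · rw [log_zero]; exact log_nonneg (by norm_num)
  · exact log_le_log h0 h

theorem norm_circleMap_sub_le {R : ℝ} (hR0 : 0 ≤ R) (hR2 : R ≤ 2) (φ : ℝ) (X : U 2) :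
    ‖circleMap 0 R φ - traceDivDet X‖ ≤ 4 := by
  refine (norm_sub_le _ _).trans ?_
  have : ‖circleMap 0 R φ‖ = R := by simp [abs_of_nonneg hR0]
  linarith [norm_traceDivDet_le X]

/-- Tonelli over the phase and `U(2)`. Since `R` and `|z|` are at most 2, subtracting from `log 4`
makes the integrands nonnegative, so integrability need not be known beforehand and can be deduced
from the equality. -/
theorem lintegral_log_norm_sub {R : ℝ} (hR0 : 0 ≤ R) (hR2 : R ≤ 2) :
    ∫⁻ X, ENNReal.ofReal (log 4 - log ‖(R : ℂ) - traceDivDet X‖) ∂(haar 2) =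
      ∫⁻ X, ENNReal.ofReal (log 4 - log (max R ‖traceDivDet X‖)) ∂(haar 2) := by
  have hpi := pi_pos
  set H : ℝ → U 2 → ℝ := fun φ X => log 4 - log ‖circleMap 0 R φ - traceDivDet X‖ with hH
  have hH0 : ∀ φ X, 0 ≤ H φ X := fun φ X =>
    sub_nonneg.mpr (log_le_log_four (norm_nonneg _) (norm_circleMap_sub_le hR0 hR2 φ X))
  have hHm : Measurable fun p : ℝ × U 2 => ENNReal.ofReal (H p.1 p.2) := by
    have h1 : Measurable fun p : ℝ × U 2 => circleMap 0 R p.1 :=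
      (continuous_circleMap 0 R).measurable.comp measurable_fst
    have h2 : Measurable fun p : ℝ × U 2 => traceDivDet p.2 :=
      measurable_traceDivDet.comp measurable_snd
    exact ((measurable_log.comp (h1.sub h2).norm).const_sub _).ennreal_ofReal
  have h1 : ∀ φ, ∫⁻ X, ENNReal.ofReal (H φ X) ∂(haar 2) =
      ∫⁻ X, ENNReal.ofReal (log 4 - log ‖(R : ℂ) - traceDivDet X‖) ∂(haar 2) := by
    intro φ
    rw [← lintegral_mul_left_eq_self
      (fun X => ENNReal.ofReal (log 4 - log ‖(R : ℂ) - traceDivDet X‖)) (phase φ)]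
    simp_rw [norm_sub_traceDivDet_phase_mul, hH]
  have h2 : ∀ X, ∫⁻ φ in Ioc 0 (2 * π), ENNReal.ofReal (H φ X) =
      ENNReal.ofReal (2 * π) * ENNReal.ofReal (log 4 - log (max R ‖traceDivDet X‖)) := by
    intro X
    have hci : IntervalIntegrable (fun φ => log ‖circleMap 0 R φ - traceDivDet X‖) volume 0 (2 * π) :=
      circleIntegrable_log_norm_sub_const (a := traceDivDet X) (c := 0) R
    have hint : IntervalIntegrable (fun φ => H φ X) volume 0 (2 * π) :=
      intervalIntegrable_const.sub hci
    rw [← ofReal_integral_eq_lintegral_ofReal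
      ((intervalIntegrable_iff_integrableOn_Ioc_of_le (by positivity)).mp hint)
      (Filter.Eventually.of_forall fun φ => hH0 φ X),
      ← ENNReal.ofReal_mul (by positivity), ← intervalIntegral.integral_of_le (by positivity),
      hH, intervalIntegral.integral_sub intervalIntegrable_const hci]
    congr 1
    have := circleAverage_log_norm_sub hR0 (traceDivDet X)
    rw [circleAverage_def, smul_eq_mul] at this
    rw [← this]
    simp
    field_simp
  have h3 : ENNReal.ofReal (2 * π) *
      ∫⁻ X, ENNReal.ofReal (log 4 - log ‖(R : ℂ) - traceDivDet X‖) ∂(haar 2) =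
      ENNReal.ofReal (2 * π) *
      ∫⁻ X, ENNReal.ofReal (log 4 - log (max R ‖traceDivDet X‖)) ∂(haar 2) := by
    rw [← lintegral_const_mul' _ (fun X => ENNReal.ofReal (log 4 - log (max R ‖traceDivDet X‖)))
      ENNReal.ofReal_ne_top]
    simp_rw [← h2]
    rw [← lintegral_lintegral_swap hHm.aemeasurable]
    simp_rw [h1]
    simp [mul_comm]
  exact (ENNReal.mul_right_inj (by simpa using hpi) ENNReal.ofReal_ne_top).mp h3

/-- Averaging over the phase replaces `log |R - z|` by `log max(R, |z|)`. -/
theorem integrable_and_integral_log_norm_sub {R : ℝ} (hR0 : 0 ≤ R) (hR2 : R ≤ 2)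
    (hi : Integrable (fun X => log (max R ‖traceDivDet X‖)) (haar 2)) :
    Integrable (fun X => log ‖(R : ℂ) - traceDivDet X‖) (haar 2) ∧
      ∫ X, log ‖(R : ℂ) - traceDivDet X‖ ∂(haar 2) =
        ∫ X, log (max R ‖traceDivDet X‖) ∂(haar 2) := by
  set f : U 2 → ℝ := fun X => log ‖(R : ℂ) - traceDivDet X‖ with hf
  set m : U 2 → ℝ := fun X => log (max R ‖traceDivDet X‖) with hm
  have hfm : Measurable f := measurable_log.comp (measurable_traceDivDet.const_sub _).norm
  have hf0 : 0 ≤ᵐ[haar 2] fun X => log 4 - f X := Filter.Eventually.of_forall fun X => by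
    have := norm_circleMap_sub_le hR0 hR2 0 X
    simp only [circleMap, zero_add, Complex.ofReal_zero, zero_mul, Complex.exp_zero, mul_one] at this
    exact sub_nonneg.mpr (log_le_log_four (norm_nonneg _) this)
  have hm0 : 0 ≤ᵐ[haar 2] fun X => log 4 - m X := Filter.Eventually.of_forall fun X =>
    sub_nonneg.mpr (log_le_log_four (le_max_of_le_left hR0)
      (max_le (by linarith) (by linarith [norm_traceDivDet_le X])))
  have hmi : Integrable (fun X => log 4 - m X) (haar 2) := (integrable_const _).sub hi
  have hl := lintegral_log_norm_sub hR0 hR2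
  have hfs : AEStronglyMeasurable (fun X => log 4 - f X) (haar 2) :=
    (hfm.const_sub _).aestronglyMeasurable
  have hfi : Integrable (fun X => log 4 - f X) (haar 2) := by
    refine ⟨hfs, ?_⟩
    rw [hasFiniteIntegral_iff_ofReal hf0, hl, ← hasFiniteIntegral_iff_ofReal hm0]
    exact hmi.2
  have hfi' : Integrable f (haar 2) := by
    exact ((integrable_const (log 4)).sub hfi).congr
      (Filter.Eventually.of_forall fun X => sub_sub_cancel _ _)
  refine ⟨hfi', ?_⟩
  have h1 : ∫ X, (log 4 - f X) ∂(haar 2) = ∫ X, (log 4 - m X) ∂(haar 2) := by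
    rw [integral_eq_lintegral_of_nonneg_ae hf0 hfs,
      integral_eq_lintegral_of_nonneg_ae hm0 hmi.aestronglyMeasurable, hl]
  rw [integral_sub (integrable_const _) hfi', integral_sub (integrable_const _) hi] at h1
  linarith

/-- Only `r = 0`, `θ = π/2` is exceptional: there the maximum vanishes and `log 0 = 0` breaks the
product rule. -/
theorem sin_sq_mul_log_max_ae (r : ℝ) :
    (fun θ => sin θ ^ 2 * log (max (2 * r) (2 * |cos θ|))) =ᵐ[volume.restrict (Ioo 0 π)]
      fun θ => log 2 * sin θ ^ 2 + sin θ ^ 2 * log (max r |cos θ|) := by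
  rw [Filter.EventuallyEq, ae_restrict_iff' measurableSet_Ioo]
  have : ∀ᵐ θ : ℝ, θ ≠ π / 2 := by rw [ae_iff]; simp
  filter_upwards [this] with θ hθ hmem
  have hc : cos θ ≠ 0 := by
    intro h
    apply hθ
    have : cos θ = cos (π / 2) := by rw [h, cos_pi_div_two]
    exact injOn_cos ⟨hmem.1.le, hmem.2.le⟩ ⟨by linarith [pi_pos], by linarith [pi_pos]⟩ this
  have hm : 0 < max r |cos θ| := lt_max_of_lt_right (abs_pos.mpr hc)
  rw [← mul_max_of_nonneg _ _ zero_le_two, log_mul two_ne_zero hm.ne']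
  ring

end UnitaryLog

theorem theorem5p1 (r : ℝ) (hr0 : 0 ≤ r) (hr1 : r < 1) :
    MeasureTheory.Integrable
        (fun X : UnitaryLog.U 2 => Real.log ‖deriv (UnitaryLog.Λ X) (r : ℂ)‖) (UnitaryLog.haar 2) ∧
      Summable (UnitaryLog.hyp32Term (1 / 2) (1 / 2) (1 / 2) (3 / 2) (3 / 2) (r ^ 2)) ∧
      ∫ X : UnitaryLog.U 2, Real.log ‖deriv (UnitaryLog.Λ X) (r : ℂ)‖ ∂(UnitaryLog.haar 2) =
        (2 * r * UnitaryLog.hyp32 (1 / 2) (1 / 2) (1 / 2) (3 / 2) (3 / 2) (r ^ 2) +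
            r * √(1 - r ^ 2) + Real.arcsin r) / Real.pi - 1 / 2 := by
  open UnitaryLog in
  -- The factors 2 match the zero radius `2r` with the normalization `|tr X| / 2` of the trace law.
  have hg : Measurable fun x : ℝ => Real.log (max (2 * r) (2 * x)) := by fun_prop
  have hs : IntegrableOn (fun θ => Real.log 2 * Real.sin θ ^ 2) (Ioo 0 Real.pi) :=
    (Continuous.integrableOn_Icc (by fun_prop)).mono_set Ioo_subset_Icc_self
  have hl := integrableOn_sin_sq_mul_log_max hr0
  have hae := sin_sq_mul_log_max_ae r
  have hgi := integrable_comp_trace hg ((hs.add hl).congr hae.symm)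
  have hgv := integral_comp_trace hg
  rw [integral_congr_ae hae, integral_add hs hl, integral_const_mul,
    integral_sin_sq_mul_log_max hr0 hr1, ← integral_Ioc_eq_integral_Ioo,
    ← intervalIntegral.integral_of_le Real.pi_pos.le, integral_sin_sq] at hgv
  have hcongr : ∀ X : U 2, Real.log (max (2 * r) (2 *
      (‖(X : Matrix (Fin 2) (Fin 2) ℂ).trace‖ / 2))) = Real.log (max (2 * r) ‖traceDivDet X‖) := by
    intro X
    rw [norm_traceDivDet, mul_div_cancel₀ _ two_ne_zero]
  simp_rw [hcongr] at hgi hgv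
  obtain ⟨h1, h2⟩ := integrable_and_integral_log_norm_sub (by linarith) (by linarith) hgi
  simp_rw [norm_deriv_Λ]
  refine ⟨h1, summable_hyp32Term (by rwa [abs_of_nonneg hr0]), ?_⟩
  rw [h2, hgv, mul_assoc 2 r, mul_hyp32_eq]
  have := Real.pi_ne_zero
  simp only [Real.sin_zero, Real.sin_pi, zero_mul, sub_zero, zero_add]
  field_simp
  ring
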